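/- Let $p>q$ be prime numbers, let $e$ be the least positive integer with $p^e\equiv 1\pmod q$, let $g\ge 1$ be an integer and $n=gq+1$, and assume $p^e>n$ and $p\ge n+q-2$. For $s\ge 1$ put $$\Phi_s(t,z)=\big((t-z_1)\cdots(t-z_n)\big)^{(p^{es}-1)/q}\in\mathbb Z[z_1,\dots,z_n][t].$$ Let $A(\Phi_s)$ be the $g\times g$ matrix whose $(u,v)$ entry is the coefficient of $t^{p^{es}v-u}$ in $\Phi_s(t,z)$, $u,v=1,\dots,g$, and let $I_s(z)$ be the $n\times g$ matrix whose entry in row $k$ and column $\ell$ is the coefficient of $t^{\ell p^{es}-1}$ in the polynomial $\Phi_s(t,z)/(t-z_k)$. Let $m\ge1$, let $\mathbb Q_p^{(m)}$ be the unramified extension of $\mathbb Q_p$ of degree $m$ in a fixed algebraic closure of $\mathbb Q_p$, generated by the roots of unity of order dividing $p^m-1$, with the extended norm $|\cdot|_p$, and let $\mathbb Z_p^{(m)}$ be its ring of integers. Put $$\mathfrak D^{(m)}_{\mathrm{KZ}}=\{a\in(\mathbb Z_p^{(m)})^n \;:\; |\det A(\Phi_1)(a)|_p=1\}.$$ For $i\neq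 j$ let $\Omega_{ij}$ be the $n\times n$ matrix with entries $-1$ at $(i,i)$ and $(j,j)$, entries $1$ at $(i,j)$ and $(j,i)$, and all other entries $0$, and let $$H_i(z)=\frac1q\sum_{j\ne i}\frac{\Omega_{ij}}{z_i-z_j},\qquad i=1,\dots,n,$$ be the Gaudin Hamiltonians. Then, as $s\to\infty$, the sequence $I_s(z)\,A(\Phi_s)(z)^{-1}$ and, for every $i=1,\dots,n$, the sequence $\frac{\partial I_s}{\partial z_i}(z)\,A(\Phi_s)(z)^{-1}$ converge uniformly on $\mathfrak D^{(m)}_{\mathrm{KZ}}$ to $n\times g$ matrices $\mathcal I(z)$ and $\mathcal I^{(i)}(z)$ with entries in $\mathbb Q_p^{(m)}$, and these limits satisfy on $\mathfrak D^{(m)}_{\mathrm{KZ}}$ the equations $$\mathcal I^{(i)}=H_i\cdot\mathcal I,\qquad i=1,\dots,n.$$ That is, the $i$-th equation holds at every point $a\in\mathfrak D^{(m)}_{\mathrm{KZ}}$ with $a_i\ne a_j$ for all $j\neq i$ (where $H_i$ is defined), and the equation obtained from it by multiplying both sides by $\prod_{j\neq i}(z_i-z_j)$, $$\prod_{j\neq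 i}(a_i-a_j)\cdot\mathcal I^{(i)}(a)=\frac1q\sum_{j\ne i}\Big(\prod_{k\neq i,j}(a_i-a_k)\Big)\,\Omega_{ij}\,\mathcal I(a),$$ holds at every point $a\in\mathfrak D^{(m)}_{\mathrm{KZ}}$. -/

import Mathlib

open Polynomial Filter

noncomputable section

/-- The unramified extension `ℚ_p^{(m)}` of `ℚ_p` of degree `m ≥ 1` inside the fixed algebraic closure
`PadicAlgCl p` of `ℚ_p`: it is generated by the roots of unity of order dividing `p ^ m - 1`.
It carries the restriction of the `p`-adic norm of `PadicAlgCl p`. -/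
def UnramifiedExt (p : ℕ) [Fact p.Prime] (m : ℕ) : IntermediateField ℚ_[p] (PadicAlgCl p) :=
  IntermediateField.adjoin ℚ_[p] {x | x ^ (p ^ m - 1) = 1}

/-- The least positive integer `e` with `p ^ e ≡ 1 (mod q)` (for distinct primes `p`, `q`). -/
def expOrder (p q : ℕ) : ℕ := orderOf (p : ZMod q)

/-- The master polynomial `Φ_s(t,z) = ((t - z_1) ⋯ (t - z_n)) ^ ((p ^ (e s) - 1) / q)`, as a polynomial
in `t` whose coefficients are polynomials in `z` over `ℤ`. -/
def masterPoly (n p q s : ℕ) : (MvPolynomial (Fin n) ℤ)[X] :=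
  (∏ i : Fin n, (X - C (MvPolynomial.X i))) ^ ((p ^ (expOrder p q * s) - 1) / q)

/-- The Hasse--Witt matrix `A(Φ_s)`, with entries `Coeff_{p ^ (e s) v - u} Φ_s(t,z)` for
`u, v = 1, …, g` (the indices of `Fin g` are shifted by one). -/
def hasseWitt (n g p q s : ℕ) : Matrix (Fin g) (Fin g) (MvPolynomial (Fin n) ℤ) :=
  Matrix.of fun u v =>
    (masterPoly n p q s).coeff (p ^ (expOrder p q * s) * ((v : ℕ) + 1) - ((u : ℕ) + 1))

/-- The `n × g` matrix `I_s(z)` whose entry in row `i` and column `ℓ` is the coefficient of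
`t ^ (ℓ p ^ (e s) - 1)` in the polynomial `Φ_s(t,z) / (t - z_i)` (an exact division for `s ≥ 1`).
Its columns are the `p ^ (e s)`-hypergeometric solutions. -/
def hypergeomSol (n g p q s : ℕ) : Matrix (Fin n) (Fin g) (MvPolynomial (Fin n) ℤ) :=
  Matrix.of fun i l =>
    (masterPoly n p q s /ₘ (X - C (MvPolynomial.X i))).coeff
      (((l : ℕ) + 1) * p ^ (expOrder p q * s) - 1)

/-- The value at `z = a` of a matrix of polynomials in `z`. -/
def evalMatrix {n : ℕ} {ι κ K : Type*} [Field K] (a : Fin n → K)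
    (M : Matrix ι κ (MvPolynomial (Fin n) ℤ)) : Matrix ι κ K :=
  M.map (MvPolynomial.aeval a)

/-- The entrywise partial derivative `∂M/∂z_i` of a matrix of polynomials in `z`. -/
def pderivMatrix {n : ℕ} {ι κ : Type*} (i : Fin n)
    (M : Matrix ι κ (MvPolynomial (Fin n) ℤ)) : Matrix ι κ (MvPolynomial (Fin n) ℤ) :=
  M.map (MvPolynomial.pderiv i)

/-- The domain `𝔇_KZ^{(m)}` of all `a ∈ (ℤ_p^{(m)})^n` with `|det A(Φ_1(t,a))|_p = 1`. -/
def domainKZ (n g p q : ℕ) [Fact p.Prime] (m : ℕ) : Set (Fin n → UnramifiedExt p m) :=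
  {a | (∀ i, ‖a i‖ ≤ 1) ∧ ‖(evalMatrix a (hasseWitt n g p q 1)).det‖ = 1}

/-- The matrix `Ω_{ij}`, for `i ≠ j`: entries `-1` at `(i,i)` and `(j,j)`, entries `1` at `(i,j)` and
`(j,i)`, all other entries zero. -/
def Omega {n : ℕ} (K : Type*) [Field K] (i j : Fin n) : Matrix (Fin n) (Fin n) K :=
  Matrix.single i j 1 + Matrix.single j i 1 - Matrix.single i i 1 - Matrix.single j j 1

/-- The Gaudin Hamiltonian `H_i(a) = (1/q) ∑_{j ≠ i} Ω_{ij} / (a_i - a_j)`, meaningful when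
`a_i ≠ a_j` for all `j ≠ i`. -/
def gaudinH {n : ℕ} {K : Type*} [Field K] (q : ℕ) (i : Fin n) (a : Fin n → K) :
    Matrix (Fin n) (Fin n) K :=
  (q : K)⁻¹ • ∑ j ∈ Finset.univ.erase i, (a i - a j)⁻¹ • Omega K i j

end

/-!
Modulo `p ^ (e * s)` the columns of `I_s` solve the KZ equations, because of two relations that
survive multiplication by `A(Φ_s)⁻¹`. First, the rows of `∂I_s/∂z_i` add up to the coefficients of
`-d/dt (Φ_s / (t - z_i))` in degrees `l * p ^ (e * s) - 1`, all divisible by `p ^ (e * s)`. Second,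
`1 / (t - z_i) - 1 / (t - z_k) = (z_i - z_k) / ((t - z_i) * (t - z_k))` expresses the difference of
the rows `i` and `k` of `I_s` through the row `k` of `∂I_s/∂z_i`, up to the factor `q`, since the
exponent of `Φ_s` is `-1 / q` modulo `p ^ (e * s)`. As `Ω_ij` has rank one, the two relations in the
limit are the `i`-th KZ equation.

Convergence is a Dwork congruence. Put `Q = p ^ e`. A `Q ^ j`-th power of a polynomial is a sum of
terms `p ^ (j - i) * G (t ^ (Q ^ i))` with `i ≤ j`, so information modulo `p ^ i` on the Cartier
operators of level `Q ^ i`, available inductively, adds up to a congruence modulo `p ^ j`: the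
coefficient rows of `E * Φ_s` and `E * Φ_(s+t)`, normalized by the Hasse-Witt matrices, agree
modulo `p ^ s`. The Hasse-Witt determinants stay invertible for all `s` because modulo `p` each is
a product of Frobenius twists of the one for `s = 1`.
-/

noncomputable section CartierOperator

variable {R : Type*} [CommRing R]

/-- The Cartier operator of level `N`, shifted by one: the coefficient of `t ^ (m + 1)` in
`cartier N f` is the coefficient of `t ^ ((m + 1) * N - 1)` in `f`. -/
def cartier (N : ℕ) [NeZero N] : R[X] →ₗ[R] R[X] where
  toFun f := contract N (X * f)
  map_add' f h := by rw [mul_add, contract_add (NeZero.ne N)]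
  map_smul' c f := by
    ext m
    simp [coeff_contract (NeZero.ne N)]

/-- The vector of the coefficients of `t ^ (N - 1), …, t ^ (g * N - 1)`. -/
def coeffRow (g N : ℕ) : R[X] →ₗ[R] (Fin g → R) :=
  LinearMap.pi fun l => lcoeff R ((l + 1) * N - 1)

theorem coeffRow_apply (g N : ℕ) (f : R[X]) (l : Fin g) :
    coeffRow g N f l = f.coeff ((l + 1) * N - 1) := rfl

theorem coeffRow_map {S : Type*} [CommRing S] (φ : R →+* S) (g N : ℕ) (f : R[X]) :
    coeffRow g N (f.map φ) = φ ∘ coeffRow g N f := by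
  ext l
  simp [coeffRow_apply]

variable {N : ℕ} [NeZero N]

theorem coeff_cartier (f : R[X]) (m : ℕ) : (cartier N f).coeff m = (X * f).coeff (m * N) :=
  coeff_contract (NeZero.ne N) (X * f) m

theorem coeff_cartier_zero (f : R[X]) : (cartier N f).coeff 0 = 0 := by
  simp [coeff_cartier]

theorem coeff_cartier_succ (f : R[X]) (m : ℕ) :
    (cartier N f).coeff (m + 1) = f.coeff ((m + 1) * N - 1) := by
  have hpos : 0 < (m + 1) * N := Nat.mul_pos m.succ_pos (NeZero.pos N)
  obtain ⟨k, hk⟩ := Nat.exists_eq_succ_of_ne_zero hpos.ne'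
  rw [coeff_cartier, hk, Nat.succ_sub_one, coeff_X_mul]

theorem cartier_mul_expand (f h : R[X]) : cartier N (f * expand R N h) = cartier N f * h := by
  simp only [cartier, LinearMap.coe_mk, AddHom.coe_mk]
  rw [← mul_assoc, contract_mul_expand (NeZero.ne N)]

theorem natDegree_cartier_le {g : ℕ} {f : R[X]} (hf : f.natDegree + 1 < (g + 1) * N) :
    (cartier N f).natDegree ≤ g := by
  refine natDegree_le_iff_coeff_eq_zero.2 fun m hm => ?_
  obtain ⟨k, rfl⟩ := Nat.exists_eq_succ_of_ne_zero (Nat.ne_zero_of_lt hm)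
  have hle : (g + 1) * N ≤ (k + 1) * N := Nat.mul_le_mul_right N (by omega)
  rw [Nat.succ_eq_add_one, coeff_cartier_succ]
  exact coeff_eq_zero_of_natDegree_lt (by omega)

theorem cartier_eq_sum_coeffRow {g : ℕ} {f : R[X]} (hf : (cartier N f).natDegree ≤ g) :
    cartier N f = ∑ l : Fin g, monomial (l + 1) (coeffRow g N f l) := by
  rw [(cartier N f).as_sum_range' (g + 1) (by omega), Finset.sum_range_succ', coeff_cartier_zero,
    map_zero, add_zero, Finset.sum_range]
  simp only [coeff_cartier_succ, coeffRow_apply]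

theorem C_dvd_cartier_mul_expand {N' : ℕ} [NeZero N'] (hN : N ∣ N') {x : R} {f : R[X]}
    (hf : C x ∣ cartier N f) (h : R[X]) : C x ∣ cartier N' (f * expand R N h) := by
  obtain ⟨M, rfl⟩ := hN
  rw [C_dvd_iff_dvd_coeff]
  intro m
  have hcoeff : (cartier (N * M) (f * expand R N h)).coeff m = (cartier N f * h).coeff (m * M) := by
    rw [← cartier_mul_expand, coeff_cartier, coeff_cartier, mul_assoc m, mul_comm N]
  rw [hcoeff]
  exact (C_dvd_iff_dvd_coeff _ _).1 (hf.mul_right h) _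

theorem C_dvd_cartier_of_dvd {N' : ℕ} [NeZero N'] (hN : N ∣ N') {x : R} {f : R[X]}
    (hf : C x ∣ cartier N f) : C x ∣ cartier N' f := by
  simpa using C_dvd_cartier_mul_expand hN hf 1

theorem dvd_coeffRow_of_C_dvd_cartier {g : ℕ} {x : R} {f : R[X]} (hf : C x ∣ cartier N f)
    (l : Fin g) : x ∣ coeffRow g N f l := by
  rw [coeffRow_apply, ← coeff_cartier_succ]
  exact (C_dvd_iff_dvd_coeff _ _).1 hf _

theorem dvd_coeffRow_derivative (g : ℕ) (f : R[X]) (l : Fin g) :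
    (N : R) ∣ coeffRow g N (derivative f) l := by
  have hpos : 0 < (l + 1 : ℕ) * N := Nat.mul_pos l.val.succ_pos (NeZero.pos N)
  rw [coeffRow_apply, coeff_derivative, ← Nat.cast_add_one, Nat.sub_add_cancel hpos, Nat.cast_mul]
  exact (dvd_mul_left (N : R) _).mul_left _

end CartierOperator

section PowerDivisibility

variable {R : Type*} [CommRing R] {p : ℕ} [Fact p.Prime]

theorem natCast_pow_dvd_of_dvd_natCast_mul (hp0 : (p : R) ∈ nonZeroDivisors R) {N v k : ℕ} {c : R}
    (hk : ¬p ^ (v + 1) ∣ k) (h : (p : R) ^ N ∣ k * c) : (p : R) ^ (N - v) ∣ c := by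
  obtain ⟨a, haN, ha⟩ := (Nat.dvd_prime_pow Fact.out).1 (Nat.gcd_dvd_left (p ^ N) k)
  have hav : a ≤ v := by
    by_contra! hlt
    exact hk ((pow_dvd_pow p hlt).trans (ha ▸ Nat.gcd_dvd_right _ _))
  have hbezout : (p : R) ^ a = p ^ N * (p ^ N).gcdA k + k * (p ^ N).gcdB k := by
    simpa [ha] using congrArg (Int.cast (R := R)) (Nat.gcd_eq_gcd_ab (p ^ N) k)
  have hmul : (p : R) ^ a * p ^ (N - a) ∣ p ^ a * c := by
    rw [← pow_add, Nat.add_sub_cancel' haN, hbezout, add_mul, mul_assoc, mul_right_comm]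
    exact dvd_add (dvd_mul_right _ _) (h.mul_right _)
  exact (pow_dvd_pow _ (Nat.sub_le_sub_left hav N)).trans
    ((dvd_cancel_left_mem_nonZeroDivisors (pow_mem hp0 a)).1 hmul)

theorem natCast_dvd_natCast_mul_coeff_pow (H : R[X]) (N k : ℕ) :
    (N : R) ∣ k * (H ^ N).coeff k := by
  rcases k with _ | k
  · simp
  have h : (derivative (H ^ N)).coeff k = N * (H ^ (N - 1) * derivative H).coeff k := by
    rw [derivative_pow, mul_assoc, coeff_C_mul]
  rw [coeff_derivative, ← Nat.cast_add_one, mul_comm] at h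
  exact ⟨_, h⟩

theorem monomial_coeff_pow_eq_mul_expand (hp0 : (p : R) ∈ nonZeroDivisors R) {e : ℕ} (he : 0 < e)
    (H : R[X]) (j k : ℕ) :
    ∃ i ≤ j, ∃ G : R[X], monomial k ((H ^ (p ^ e) ^ j).coeff k) =
      C ((p : R) ^ (j - i)) * expand R ((p ^ e) ^ i) G := by
  set i := Nat.findGreatest (fun i => (p ^ e) ^ i ∣ k) j
  have hij : i ≤ j := Nat.findGreatest_le j
  obtain ⟨k', hk'⟩ : (p ^ e) ^ i ∣ k :=
    Nat.findGreatest_spec (P := fun i => (p ^ e) ^ i ∣ k) (Nat.zero_le j) (by simp)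
  obtain ⟨d, hd⟩ : (p : R) ^ (j - i) ∣ (H ^ (p ^ e) ^ j).coeff k := by
    rcases hij.eq_or_lt with h | h
    · simp [h]
    have hndvd : ¬p ^ (e * (i + 1) - 1 + 1) ∣ k := by
      rw [Nat.sub_add_cancel (Nat.mul_pos he i.succ_pos), pow_mul]
      exact Nat.findGreatest_is_greatest (P := fun i => (p ^ e) ^ i ∣ k) i.lt_add_one h
    have hdvd : (p : R) ^ (e * j) ∣ k * (H ^ (p ^ e) ^ j).coeff k := by
      simpa [← pow_mul] using natCast_dvd_natCast_mul_coeff_pow H ((p ^ e) ^ j) k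
    refine (pow_dvd_pow _ ?_).trans (natCast_pow_dvd_of_dvd_natCast_mul hp0 hndvd hdvd)
    have hle : j - (i + 1) ≤ e * j - e * (i + 1) :=
      Nat.mul_sub e j (i + 1) ▸ Nat.le_mul_of_pos_left _ he
    have hpos : 0 < e * (i + 1) := Nat.mul_pos he i.succ_pos
    have hmono : e * (i + 1) ≤ e * j := Nat.mul_le_mul_left e h
    omega
  refine ⟨i, hij, monomial k' d, ?_⟩
  rw [expand_monomial, C_mul_monomial, ← hd, mul_comm k', ← hk']

end PowerDivisibility

noncomputable section DworkCongruence

variable {R : Type*} [CommRing R] {g : ℕ}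

theorem C_dvd_linearMap_apply {x : R} {f : R[X]} (L : R[X] →ₗ[R] R[X]) (h : C x ∣ f) :
    C x ∣ L f := by
  obtain ⟨f', rfl⟩ := h
  rw [← smul_eq_C_mul, map_smul, smul_eq_C_mul]
  exact dvd_mul_right _ _

/-- The matrix with rows `coeffRow g N (B u * W)`; for `B u = X ^ u` it is the Hasse-Witt matrix
of `W`. -/
def coeffMatrix (N : ℕ) (B : Fin g → R[X]) (W : R[X]) : Matrix (Fin g) (Fin g) R :=
  Matrix.of fun u => coeffRow g N (B u * W)

/-- The coordinates of `coeffRow g N (E * W)` with respect to the rows of `coeffMatrix N B W`.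
They are meaningful only when that matrix is invertible. -/
def normalizedRow (N : ℕ) (B : Fin g → R[X]) (W : R[X]) : R[X] →ₗ[R] (Fin g → R) :=
  (coeffMatrix N B W)⁻¹.vecMulLinear ∘ₗ coeffRow g N ∘ₗ LinearMap.mulRight R W

/-- The difference of `E` and the combination of the `B u` that has the same coefficients of
`t ^ (N - 1), …, t ^ (g * N - 1)` after multiplication by `W`. -/
def reduction (N : ℕ) (B : Fin g → R[X]) (W E : R[X]) : R[X] :=
  E - ∑ u, normalizedRow N B W E u • B u

variable {N : ℕ} {B : Fin g → R[X]} {W : R[X]}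

theorem normalizedRow_apply (E : R[X]) :
    normalizedRow N B W E = Matrix.vecMul (coeffRow g N (E * W)) (coeffMatrix N B W)⁻¹ := rfl

theorem dvd_normalizedRow {x : R} {E : R[X]} (h : ∀ l, x ∣ coeffRow g N (E * W) l) (l : Fin g) :
    x ∣ normalizedRow N B W E l := by
  simp only [normalizedRow_apply, Matrix.vecMul, dotProduct]
  exact Finset.dvd_sum fun m _ => (h m).mul_right _

theorem vecMul_coeffMatrix (c : Fin g → R) :
    Matrix.vecMul c (coeffMatrix N B W) = coeffRow g N ((∑ u, c u • B u) * W) := by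
  simp only [Finset.sum_mul, smul_mul_assoc, map_sum, map_smul]
  ext l
  simp [Matrix.vecMul, dotProduct, coeffMatrix]

theorem normalizedRow_sum_smul (hdet : IsUnit (coeffMatrix N B W).det) (c : Fin g → R) :
    normalizedRow N B W (∑ u, c u • B u) = c := by
  rw [normalizedRow_apply, ← vecMul_coeffMatrix, Matrix.vecMul_vecMul,
    Matrix.mul_nonsing_inv _ hdet, Matrix.vecMul_one]

theorem coeffRow_reduction_mul (hdet : IsUnit (coeffMatrix N B W).det) (E : R[X]) :
    coeffRow g N (reduction N B W E * W) = 0 := by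
  rw [reduction, sub_mul, map_sub, ← vecMul_coeffMatrix, normalizedRow_apply,
    Matrix.vecMul_vecMul, Matrix.nonsing_inv_mul _ hdet, Matrix.vecMul_one, sub_self]

theorem natDegree_cartier_reduction_mul_le [NeZero N] {E : R[X]}
    (hB : ∀ u, (cartier N (B u * W)).natDegree ≤ g) (hE : (cartier N (E * W)).natDegree ≤ g) :
    (cartier N (reduction N B W E * W)).natDegree ≤ g := by
  simp only [reduction, sub_mul, Finset.sum_mul, smul_mul_assoc, map_sub, map_sum, map_smul]
  refine (natDegree_sub_le_of_le hE (natDegree_sum_le_of_forall_le _ _ fun u _ => ?_)).trans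
    (max_self g).le
  exact (natDegree_smul_le (normalizedRow N B W E u) _).trans (hB u)

theorem cartier_reduction_mul [NeZero N] (hdet : IsUnit (coeffMatrix N B W).det) {E : R[X]}
    (hB : ∀ u, (cartier N (B u * W)).natDegree ≤ g) (hE : (cartier N (E * W)).natDegree ≤ g) :
    cartier N (reduction N B W E * W) = 0 := by
  rw [cartier_eq_sum_coeffRow (natDegree_cartier_reduction_mul_le hB hE),
    coeffRow_reduction_mul hdet]
  simp

/-- A sequence of polynomials `W s` of level `Q ^ s` that telescope through `Q ^ i`-th powers, and
whose coefficient matrices with respect to the multipliers `B u` are invertible. -/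
structure IsDworkTower (Q : ℕ) [NeZero Q] (B : Fin g → R[X]) (W Φ : ℕ → R[X]) : Prop where
  apply_add : ∀ i k, 0 < i → W (i + k) = W i * Φ k ^ Q ^ i
  natDegree_le : ∀ s, 0 < s → ∀ u, (cartier (Q ^ s) (B u * W s)).natDegree ≤ g
  isUnit_det : ∀ s, 0 < s → IsUnit (coeffMatrix (Q ^ s) B (W s)).det

variable {p e : ℕ} [Fact p.Prime] {W Φ : ℕ → R[X]} {E : R[X]}

theorem IsDworkTower.dvd_normalizedRow_add_sub {Q : ℕ} [NeZero Q] (hW : IsDworkTower Q B W Φ)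
    {x : R} {i : ℕ} (hi : 0 < i)
    (h : ∀ H, C x ∣ cartier (Q ^ i) (reduction (Q ^ i) B (W i) E * W i * H ^ Q ^ i)) (k : ℕ)
    (l : Fin g) :
    x ∣ normalizedRow (Q ^ (i + k)) B (W (i + k)) E l - normalizedRow (Q ^ i) B (W i) E l := by
  have hrow : normalizedRow (Q ^ (i + k)) B (W (i + k)) (reduction (Q ^ i) B (W i) E) l =
      normalizedRow (Q ^ (i + k)) B (W (i + k)) E l - normalizedRow (Q ^ i) B (W i) E l := by
    rw [reduction, map_sub, normalizedRow_sum_smul (hW.isUnit_det _ (by omega)), Pi.sub_apply]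
  rw [← hrow]
  refine dvd_normalizedRow (fun m => ?_) l
  rw [hW.apply_add i k hi, ← mul_assoc]
  exact dvd_coeffRow_of_C_dvd_cartier
    (C_dvd_cartier_of_dvd (pow_dvd_pow Q (Nat.le_add_right i k)) (h (Φ k))) m

theorem C_dvd_reduction_sub_reduction {N N' : ℕ} {W W' : R[X]} {x : R}
    (h : ∀ u, x ∣ normalizedRow N' B W' E u - normalizedRow N B W E u) :
    C x ∣ reduction N B W E - reduction N' B W' E := by
  rw [reduction, reduction, sub_sub_sub_cancel_left, ← Finset.sum_sub_distrib]
  refine Finset.dvd_sum fun u _ => ?_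
  rw [← sub_smul, smul_eq_C_mul]
  exact (_root_.map_dvd C (h u)).mul_right _

theorem IsDworkTower.C_dvd_cartier_reduction_mul_of_le {Q : ℕ} [NeZero Q]
    (hW : IsDworkTower Q B W Φ) {x : R} {i j : ℕ} (hi : 0 < i) (hij : i ≤ j)
    (h : ∀ H, C x ∣ cartier (Q ^ i) (reduction (Q ^ i) B (W i) E * W i * H ^ Q ^ i)) :
    C x ∣ cartier (Q ^ i) (reduction (Q ^ j) B (W j) E * W j) := by
  obtain ⟨k, rfl⟩ := Nat.exists_eq_add_of_le hij
  set D := reduction (Q ^ i) B (W i) E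
  set D' := reduction (Q ^ (i + k)) B (W (i + k)) E
  have hred : C x ∣ D - D' :=
    C_dvd_reduction_sub_reduction (hW.dvd_normalizedRow_add_sub hi h k)
  have hdiff : C x ∣ cartier (Q ^ i) (D * W (i + k)) - cartier (Q ^ i) (D' * W (i + k)) := by
    rw [← map_sub, ← sub_mul]
    exact C_dvd_linearMap_apply _ (hred.mul_right _)
  have hD : C x ∣ cartier (Q ^ i) (D * W (i + k)) := by
    rw [hW.apply_add i k hi, ← mul_assoc]
    exact h (Φ k)
  exact (dvd_sub_right hD).1 hdiff

/-- The weight `H ^ Q ^ j` splits into monomials `p ^ (j - i) * G (t ^ Q ^ i)`, which reduces the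
claim at level `j` to the divisibility of `cartier (Q ^ i)` by `p ^ i`, known from level `i`. -/
theorem IsDworkTower.C_dvd_cartier_reduction_mul_pow (hp0 : (p : R) ∈ nonZeroDivisors R)
    (he : 0 < e) (hW : IsDworkTower (p ^ e) B W Φ)
    (hE : ∀ s, 0 < s → (cartier ((p ^ e) ^ s) (E * W s)).natDegree ≤ g) (j : ℕ) (hj : 0 < j)
    (H : R[X]) :
    C ((p : R) ^ j) ∣
      cartier ((p ^ e) ^ j) (reduction ((p ^ e) ^ j) B (W j) E * W j * H ^ (p ^ e) ^ j) := by
  induction j using Nat.strong_induction_on generalizing H with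
  | _ j ih =>
  set D := reduction ((p ^ e) ^ j) B (W j) E * W j
  have hlevel : ∀ i ≤ j, C ((p : R) ^ i) ∣ cartier ((p ^ e) ^ i) D := by
    intro i hij
    rcases i.eq_zero_or_pos with rfl | hi
    · simp
    rcases hij.eq_or_lt with rfl | hlt
    · rw [cartier_reduction_mul (hW.isUnit_det i hj) (hW.natDegree_le i hj) (hE i hj)]
      exact dvd_zero _
    · exact hW.C_dvd_cartier_reduction_mul_of_le hi hij (ih i hlt hi)
  rw [(H ^ (p ^ e) ^ j).as_sum_support, Finset.mul_sum, map_sum]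
  refine Finset.dvd_sum fun k _ => ?_
  obtain ⟨i, hij, G, hG⟩ := monomial_coeff_pow_eq_mul_expand hp0 he H j k
  rw [hG, mul_left_comm, ← smul_eq_C_mul, map_smul, smul_eq_C_mul, ← Nat.sub_add_cancel hij,
    pow_add, C_mul, Nat.sub_add_cancel hij]
  exact mul_dvd_mul_left _
    (C_dvd_cartier_mul_expand (pow_dvd_pow _ hij) (hlevel i hij) G)

theorem IsDworkTower.pow_dvd_normalizedRow_add_sub (hp0 : (p : R) ∈ nonZeroDivisors R)
    (he : 0 < e) (hW : IsDworkTower (p ^ e) B W Φ)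
    (hE : ∀ s, 0 < s → (cartier ((p ^ e) ^ s) (E * W s)).natDegree ≤ g) {s : ℕ} (hs : 0 < s)
    (k : ℕ) (l : Fin g) :
    (p : R) ^ s ∣ normalizedRow ((p ^ e) ^ (s + k)) B (W (s + k)) E l -
      normalizedRow ((p ^ e) ^ s) B (W s) E l :=
  hW.dvd_normalizedRow_add_sub hs (hW.C_dvd_cartier_reduction_mul_pow hp0 he hE s hs) k l

end DworkCongruence

noncomputable section HasseWitt

variable {R : Type*} [CommRing R] {g : ℕ}

/-- The Hasse-Witt matrix of `P` of level `N`, with entries the coefficients of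
`t ^ ((l + 1) * N - 1)` in `t ^ u * P`. -/
def hasseWittMatrix (g N : ℕ) (P : R[X]) : Matrix (Fin g) (Fin g) R :=
  coeffMatrix N (fun u : Fin g => X ^ (u : ℕ)) P

theorem hasseWittMatrix_map {S : Type*} [CommRing S] (φ : R →+* S) (N : ℕ) (P : R[X]) :
    hasseWittMatrix g N (P.map φ) = (hasseWittMatrix g N P).map φ := by
  ext u l
  have hmap : X ^ (u : ℕ) * P.map φ = (X ^ (u : ℕ) * P).map φ := by simp
  simp only [hasseWittMatrix, coeffMatrix, Matrix.of_apply, Matrix.map_apply, hmap, coeffRow_map,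
    Function.comp_apply]

theorem det_hasseWittMatrix_map {S : Type*} [CommRing S] (φ : R →+* S) (N : ℕ) (P : R[X]) :
    (hasseWittMatrix g N (P.map φ)).det = φ (hasseWittMatrix g N P).det := by
  rw [hasseWittMatrix_map, RingHom.map_det, RingHom.mapMatrix_apply]

variable {N : ℕ} [NeZero N]

theorem coeffRow_mul_expand {f : R[X]} (hf : (cartier N f).natDegree ≤ g) (N' : ℕ) [NeZero N']
    (h : R[X]) :
    coeffRow g (N * N') (f * expand R N h) =
      Matrix.vecMul (coeffRow g N f) (hasseWittMatrix g N' h) := by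
  ext l
  have hcoeff : coeffRow g (N * N') (f * expand R N h) l =
      (cartier N f * h).coeff ((l + 1) * N') := by
    rw [coeffRow_apply, ← coeff_cartier_succ, ← cartier_mul_expand, coeff_cartier, coeff_cartier,
      mul_assoc (l.val + 1), mul_comm N]
  rw [hcoeff, cartier_eq_sum_coeffRow hf, Finset.sum_mul, finsetSum_coeff]
  refine Finset.sum_congr rfl fun m _ => ?_
  rw [← C_mul_X_pow_eq_monomial, mul_assoc, coeff_C_mul, pow_succ', mul_assoc, ← coeff_cartier,
    coeff_cartier_succ]
  rfl

theorem hasseWittMatrix_mul_expand {P : R[X]} (hP : g + P.natDegree < (g + 1) * N) (N' : ℕ)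
    [NeZero N'] (P' : R[X]) :
    hasseWittMatrix g (N * N') (P * expand R N P') =
      hasseWittMatrix g N P * hasseWittMatrix g N' P' := by
  ext u l
  have hdeg : (cartier N (X ^ (u : ℕ) * P)).natDegree ≤ g := by
    refine natDegree_cartier_le ?_
    have hmul := natDegree_mul_le (p := X ^ (u : ℕ)) (q := P)
    have hpow := natDegree_X_pow_le (R := R) (u : ℕ)
    omega
  rw [Matrix.mul_apply_eq_vecMul]
  refine congrFun (Eq.trans ?_ (coeffRow_mul_expand hdeg N' P')) l
  simp only [hasseWittMatrix, coeffMatrix, mul_assoc]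
  rfl

theorem det_hasseWittMatrix_mul_pow (p : ℕ) [Fact p.Prime] [CharP R p] {k : ℕ} {P : R[X]}
    (hP : g + P.natDegree < (g + 1) * p ^ k) (N : ℕ) [NeZero N] (P' : R[X]) :
    (hasseWittMatrix g (p ^ k * N) (P * P' ^ p ^ k)).det =
      (hasseWittMatrix g (p ^ k) P).det * (hasseWittMatrix g N P').det ^ p ^ k := by
  rw [← map_iterateFrobenius_expand, map_expand, hasseWittMatrix_mul_expand hP, Matrix.det_mul,
    det_hasseWittMatrix_map, iterateFrobenius_def]

/-- Modulo `p` a `p ^ k`-th power is a polynomial in `t ^ p ^ k`, so the determinant factors. -/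
theorem isUnit_det_hasseWittMatrix_mul_pow [IsLocalRing R] {p : ℕ} [Fact p.Prime]
    (hpR : (p : R) ∈ IsLocalRing.maximalIdeal R) {k : ℕ} {P : R[X]}
    (hP : g + P.natDegree < (g + 1) * p ^ k) {P' : R[X]}
    (h : IsUnit (hasseWittMatrix g (p ^ k) P).det) (h' : IsUnit (hasseWittMatrix g N P').det) :
    IsUnit (hasseWittMatrix g (p ^ k * N) (P * P' ^ p ^ k)).det := by
  set π := IsLocalRing.residue R
  have hp0 : (p : IsLocalRing.ResidueField R) = 0 := by
    rw [← map_natCast π, IsLocalRing.residue_eq_zero_iff]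
    exact hpR
  have : CharP (IsLocalRing.ResidueField R) p :=
    ringChar.of_eq (CharP.ringChar_of_prime_eq_zero Fact.out hp0)
  have hPπ : g + (P.map π).natDegree < (g + 1) * p ^ k :=
    (Nat.add_le_add_left natDegree_map_le g).trans_lt hP
  refine isUnit_of_map_unit π _ ?_
  rw [← det_hasseWittMatrix_map, Polynomial.map_mul, Polynomial.map_pow,
    det_hasseWittMatrix_mul_pow p hPπ, det_hasseWittMatrix_map, det_hasseWittMatrix_map]
  exact (h.map π).mul ((h'.map π).pow _)

end HasseWitt

noncomputable section MasterExponents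

variable {p q g : ℕ}

/-- The exponent `(p ^ (e * s) - 1) / q` of the master polynomial `Φ_s`; the division is exact. -/
def masterExp (p q s : ℕ) : ℕ := (p ^ (expOrder p q * s) - 1) / q

theorem mul_masterExp_add_one [Fact p.Prime] (s : ℕ) :
    q * masterExp p q s + 1 = (p ^ expOrder p q) ^ s := by
  have hdvd : q ∣ p ^ (expOrder p q * s) - 1 := by
    rw [← Nat.modEq_iff_dvd' (Nat.one_le_pow _ _ (NeZero.pos p)), ← ZMod.natCast_eq_natCast_iff]
    simp [expOrder, pow_mul, pow_orderOf_eq_one]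
  rw [masterExp, Nat.mul_div_cancel' hdvd, pow_mul,
    Nat.sub_add_cancel (Nat.one_le_pow _ _ (pow_pos (NeZero.pos p) _))]

theorem masterExp_add [Fact p.Prime] (hq : 0 < q) (i k : ℕ) :
    masterExp p q (i + k) = masterExp p q i + masterExp p q k * (p ^ expOrder p q) ^ i := by
  have hi := mul_masterExp_add_one (p := p) (q := q) i
  have hk := mul_masterExp_add_one (p := p) (q := q) k
  have hik := mul_masterExp_add_one (p := p) (q := q) (i + k)
  refine Nat.eq_of_mul_eq_mul_left hq (Nat.add_right_cancel (m := 1) ?_)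
  rw [hik, pow_add, ← hk, ← hi]
  ring

theorem expOrder_pos (hq : 0 < q) (hq2 : 2 * q < p ^ expOrder p q) : 0 < expOrder p q := by
  refine Nat.pos_of_ne_zero fun he => ?_
  rw [he, pow_zero] at hq2
  omega

theorem two_le_masterExp [Fact p.Prime] (hq : 0 < q) (hq2 : 2 * q < p ^ expOrder p q) {s : ℕ}
    (hs : 0 < s) : 2 ≤ masterExp p q s := by
  have hle : p ^ expOrder p q ≤ (p ^ expOrder p q) ^ s := Nat.le_self_pow hs.ne' _
  have hM := mul_masterExp_add_one (p := p) (q := q) s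
  by_contra! hlt
  have := Nat.mul_le_mul_left q (Nat.le_of_lt_succ hlt)
  omega

theorem two_mul_lt_pow_expOrder [Fact p.Prime] (hg : 0 < g)
    (h : g * q + 1 < p ^ expOrder p q) : 2 * q < p ^ expOrder p q := by
  have hM : q * masterExp p q 1 + 1 = p ^ expOrder p q := by
    rw [mul_masterExp_add_one, pow_one]
  have hgM : g < masterExp p q 1 := lt_of_mul_lt_mul_left' (a := q) (by linarith)
  nlinarith

theorem pow_dvd_pow_expOrder_pow {R : Type*} [CommSemiring R] (hq : 0 < q)
    (hq2 : 2 * q < p ^ expOrder p q) (s : ℕ) :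
    (p : R) ^ s ∣ (((p ^ expOrder p q) ^ s : ℕ) : R) := by
  rw [← pow_mul, Nat.cast_pow]
  exact pow_dvd_pow _ (Nat.le_mul_of_pos_left s (expOrder_pos hq hq2))

theorem pow_dvd_masterExp_add_sub {R : Type*} [CommRing R] [Fact p.Prime] (hq : 0 < q)
    (hq2 : 2 * q < p ^ expOrder p q) (s t : ℕ) :
    (p : R) ^ s ∣ (masterExp p q (s + t) : R) - masterExp p q s := by
  rw [masterExp_add hq, Nat.cast_add, add_sub_cancel_left, Nat.cast_mul]
  exact (pow_dvd_pow_expOrder_pow hq hq2 s).mul_left _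

end MasterExponents

noncomputable section MasterRow

variable {R : Type*} [CommRing R] {p q g M : ℕ} {E F : R[X]}

theorem natDegree_mul_pow_sub_two_lt (hM : 2 ≤ M) (hF : F.natDegree ≤ (g + 1) * q)
    (hE : E.natDegree < 2 * ((g + 1) * q) + g) :
    (E * F ^ (M - 2)).natDegree + 1 < (g + 1) * (q * M + 1) := by
  obtain ⟨M, rfl⟩ := Nat.exists_eq_add_of_le' hM
  calc (E * F ^ M).natDegree + 1 ≤ E.natDegree + M * F.natDegree + 1 := by
        gcongr; exact natDegree_mul_le_of_le le_rfl natDegree_pow_le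
    _ ≤ E.natDegree + M * ((g + 1) * q) + 1 := by gcongr
    _ < 2 * ((g + 1) * q) + g + M * ((g + 1) * q) + 1 := by gcongr
    _ = (g + 1) * (q * (M + 2) + 1) := by ring

theorem add_natDegree_pow_lt (hF : F.natDegree ≤ (g + 1) * q) :
    g + (F ^ M).natDegree < (g + 1) * (q * M + 1) :=
  calc g + (F ^ M).natDegree ≤ g + M * ((g + 1) * q) := by
        gcongr; exact natDegree_pow_le.trans (Nat.mul_le_mul_left M hF)
    _ < g + M * ((g + 1) * q) + 1 := Nat.lt_succ_self _
    _ = (g + 1) * (q * M + 1) := by ring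

theorem natDegree_X_pow_mul_sq_lt (hF : F.natDegree ≤ (g + 1) * q) (u : Fin g) :
    (X ^ (u : ℕ) * F ^ 2).natDegree < 2 * ((g + 1) * q) + g :=
  calc (X ^ (u : ℕ) * F ^ 2).natDegree ≤ u + 2 * F.natDegree :=
        natDegree_mul_le_of_le (natDegree_X_pow_le _) natDegree_pow_le
    _ < 2 * ((g + 1) * q) + g := by omega

theorem isUnit_det_hasseWittMatrix_masterExp [Fact p.Prime] [IsLocalRing R]
    (hpR : (p : R) ∈ IsLocalRing.maximalIdeal R) (hq : 0 < q) (hF : F.natDegree ≤ (g + 1) * q)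
    (h1 : IsUnit (hasseWittMatrix g (p ^ expOrder p q) (F ^ masterExp p q 1)).det) {s : ℕ}
    (hs : 0 < s) :
    IsUnit (hasseWittMatrix g ((p ^ expOrder p q) ^ s) (F ^ masterExp p q s)).det := by
  induction s, hs using Nat.le_induction with
  | base => simpa using h1
  | succ s _ ih =>
    have hdeg := mul_masterExp_add_one (p := p) (q := q) s ▸
      add_natDegree_pow_lt (M := masterExp p q s) hF
    rw [← pow_mul] at ih hdeg
    rw [masterExp_add hq, pow_add F, pow_mul F, pow_succ, ← pow_mul]
    exact isUnit_det_hasseWittMatrix_mul_pow hpR hdeg ih h1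

/-- The coefficient row of `E * F ^ (M_s - 2)` at level `s`, normalized by the Hasse-Witt matrix
of `F ^ M_s`, where `M_s = masterExp p q s`. Here `E` replaces two of the factors `F` of the master
polynomial, because the entries of the solutions and of their derivatives lack two linear factors
at most. -/
def masterRow (g p q : ℕ) (F : R[X]) (s : ℕ) : R[X] →ₗ[R] (Fin g → R) :=
  normalizedRow ((p ^ expOrder p q) ^ s) (fun u => X ^ (u : ℕ) * F ^ 2) (F ^ (masterExp p q s - 2))

theorem coeffMatrix_X_pow_mul_sq (N : ℕ) (hM : 2 ≤ M) :
    coeffMatrix N (fun u : Fin g => X ^ (u : ℕ) * F ^ 2) (F ^ (M - 2)) =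
      hasseWittMatrix g N (F ^ M) := by
  simp only [hasseWittMatrix, coeffMatrix, mul_assoc, ← pow_add, Nat.add_sub_cancel' hM]

theorem masterRow_apply [Fact p.Prime] (hq : 0 < q) (hq2 : 2 * q < p ^ expOrder p q) {s : ℕ}
    (hs : 0 < s) :
    masterRow g p q F s E =
      Matrix.vecMul (coeffRow g ((p ^ expOrder p q) ^ s) (E * F ^ (masterExp p q s - 2)))
        (hasseWittMatrix g ((p ^ expOrder p q) ^ s) (F ^ masterExp p q s))⁻¹ := by
  rw [masterRow, normalizedRow_apply, coeffMatrix_X_pow_mul_sq _ (two_le_masterExp hq hq2 hs)]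

theorem natDegree_cartier_mul_pow_masterExp_le [Fact p.Prime] (hq : 0 < q)
    (hq2 : 2 * q < p ^ expOrder p q) (hF : F.natDegree ≤ (g + 1) * q)
    (hE : E.natDegree < 2 * ((g + 1) * q) + g) {s : ℕ} (hs : 0 < s) :
    (cartier ((p ^ expOrder p q) ^ s) (E * F ^ (masterExp p q s - 2))).natDegree ≤ g := by
  refine natDegree_cartier_le ?_
  rw [← mul_masterExp_add_one]
  exact natDegree_mul_pow_sub_two_lt (two_le_masterExp hq hq2 hs) hF hE

theorem isDworkTower_pow_masterExp [Fact p.Prime] [IsLocalRing R]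
    (hpR : (p : R) ∈ IsLocalRing.maximalIdeal R) (hq : 0 < q) (hq2 : 2 * q < p ^ expOrder p q)
    (hF : F.natDegree ≤ (g + 1) * q)
    (h1 : IsUnit (hasseWittMatrix g (p ^ expOrder p q) (F ^ masterExp p q 1)).det) :
    IsDworkTower (p ^ expOrder p q) (fun u : Fin g => X ^ (u : ℕ) * F ^ 2)
      (fun s => F ^ (masterExp p q s - 2)) (fun s => F ^ masterExp p q s) where
  apply_add i k hi := by
    rw [← pow_mul, ← pow_add, masterExp_add hq, Nat.sub_add_comm (two_le_masterExp hq hq2 hi)]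
  natDegree_le s hs u :=
    natDegree_cartier_mul_pow_masterExp_le hq hq2 hF (natDegree_X_pow_mul_sq_lt hF u) hs
  isUnit_det s hs := by
    rw [coeffMatrix_X_pow_mul_sq _ (two_le_masterExp hq hq2 hs)]
    exact isUnit_det_hasseWittMatrix_masterExp hpR hq hF h1 hs

theorem pow_dvd_masterRow_add_sub [Fact p.Prime] [IsLocalRing R]
    (hpR : (p : R) ∈ IsLocalRing.maximalIdeal R) (hp0 : (p : R) ∈ nonZeroDivisors R) (hq : 0 < q)
    (hq2 : 2 * q < p ^ expOrder p q) (hF : F.natDegree ≤ (g + 1) * q)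
    (h1 : IsUnit (hasseWittMatrix g (p ^ expOrder p q) (F ^ masterExp p q 1)).det)
    (hE : E.natDegree < 2 * ((g + 1) * q) + g) {s : ℕ} (hs : 0 < s) (k : ℕ) (l : Fin g) :
    (p : R) ^ s ∣ masterRow g p q F (s + k) E l - masterRow g p q F s E l :=
  (isDworkTower_pow_masterExp hpR hq hq2 hF h1).pow_dvd_normalizedRow_add_sub hp0
    (expOrder_pos hq hq2)
    (fun _ hi => natDegree_cartier_mul_pow_masterExp_le hq hq2 hF hE hi) hs k l

end MasterRow

section LinearFactors

open Lagrange (nodal natDegree_nodal nodal_eq_mul_nodal_erase derivative_nodal)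
open Finset (univ)

variable {R S ι : Type*} [CommRing R] [CommRing S]

theorem map_nodal (φ : R →+* S) (s : Finset ι) (a : ι → R) :
    (nodal s a).map φ = nodal s (φ ∘ a) := by
  simp [nodal, Polynomial.map_prod]

theorem natDegree_nodal_univ_mul_nodal_erase_lt [Nontrivial R] [Fintype ι] [DecidableEq ι]
    (a : ι → R) (k : ι) :
    (nodal univ a * nodal (univ.erase k) a).natDegree < 2 * Fintype.card ι := by
  have hk := Finset.card_erase_lt_of_mem (Finset.mem_univ k)
  refine natDegree_mul_le.trans_lt ?_
  rw [natDegree_nodal, natDegree_nodal, ← Finset.card_univ]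
  omega

theorem natDegree_nodal_erase_mul_nodal_erase_lt [Nontrivial R] [Fintype ι] [DecidableEq ι]
    (a : ι → R) (i k : ι) :
    (nodal (univ.erase i) a * nodal (univ.erase k) a).natDegree < 2 * Fintype.card ι := by
  have hi := Finset.card_erase_lt_of_mem (Finset.mem_univ i)
  have hk := Finset.card_erase_lt_of_mem (Finset.mem_univ k)
  refine natDegree_mul_le.trans_lt ?_
  rw [natDegree_nodal, natDegree_nodal, ← Finset.card_univ]
  omega

theorem nodal_mul_nodal_erase_sub [DecidableEq ι] {s : Finset ι} (a : ι → R) {i k : ι}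
    (hi : i ∈ s) (hk : k ∈ s) :
    nodal s a * nodal (s.erase i) a - nodal s a * nodal (s.erase k) a =
      C (a i - a k) * (nodal (s.erase i) a * nodal (s.erase k) a) := by
  have hFi := nodal_eq_mul_nodal_erase (v := a) hi
  have hFk := nodal_eq_mul_nodal_erase (v := a) hk
  rw [C_sub]
  linear_combination nodal (s.erase i) a * hFk - nodal (s.erase k) a * hFi

theorem derivation_mul_mul_pow_succ {A : Type*} [CommSemiring A] [Algebra A R]
    (D : Derivation A R R) (x y : R) (m : ℕ) :
    D (y * (x * y) ^ (m + 1)) = ((m + 2) * (y * D (x * y)) - D x * y ^ 2) * (x * y) ^ m := by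
  rw [D.leibniz, D.leibniz_pow, D.leibniz x y, Nat.add_sub_cancel]
  simp only [smul_eq_mul, nsmul_eq_mul, Nat.cast_add, Nat.cast_one]
  ring

theorem derivative_nodal_erase_mul_pow [DecidableEq ι] {s : Finset ι} (a : ι → R) {i : ι}
    (hi : i ∈ s) {M : ℕ} (hM : 2 ≤ M) :
    derivative (nodal (s.erase i) a * nodal s a ^ (M - 1)) =
      ((M : R) • ∑ j ∈ s, nodal (s.erase i) a * nodal (s.erase j) a - nodal (s.erase i) a ^ 2) *
        nodal s a ^ (M - 2) := by
  obtain ⟨m, rfl⟩ := Nat.exists_eq_add_of_le' hM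
  have h := derivation_mul_mul_pow_succ (derivative' (R := R)) (X - C (a i))
    (nodal (s.erase i) a) m
  rw [← nodal_eq_mul_nodal_erase hi] at h
  simp only [derivative'_apply, derivative_nodal, derivative_X_sub_C, one_mul] at h
  rw [← Finset.mul_sum, smul_eq_C_mul, map_natCast, Nat.cast_add, Nat.cast_ofNat]
  exact h

end LinearFactors

noncomputable section CoefficientwisePartialDerivative

open Lagrange (nodal nodal_eq_mul_nodal_erase)
open Finset (univ)

variable {n : ℕ}

/-- The coefficientwise extension of `∂/∂z_i` to polynomials in `t`. -/
def coeffPDeriv (i : Fin n) :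
    Derivation ℤ (MvPolynomial (Fin n) ℤ)[X] (MvPolynomial (Fin n) ℤ)[X] :=
  PolynomialModule.equivPolynomialSelf.toLinearMap.compDer (MvPolynomial.pderiv i).mapCoeffs

theorem coeff_coeffPDeriv (i : Fin n) (f : (MvPolynomial (Fin n) ℤ)[X]) (m : ℕ) :
    (coeffPDeriv i f).coeff m = MvPolynomial.pderiv i (f.coeff m) := rfl

theorem coeffPDeriv_X_sub_C (i k : Fin n) :
    coeffPDeriv i (X - C (MvPolynomial.X k)) = if i = k then -1 else 0 := by
  ext m : 1
  rw [coeff_coeffPDeriv, coeff_sub, map_sub, coeff_X, coeff_C]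
  rcases eq_or_ne i k with rfl | h
  · by_cases hm : m = 0 <;> simp [hm, apply_ite, coeff_one]
  · by_cases hm : m = 0 <;> simp [hm, h, apply_ite, MvPolynomial.pderiv_X_of_ne h.symm]

theorem coeffPDeriv_nodal_erase_self (i : Fin n) :
    coeffPDeriv i (nodal (univ.erase i) MvPolynomial.X) = 0 := by
  refine Finset.prod_induction _ (fun f => coeffPDeriv i f = 0) (fun f h hf hh => ?_)
    (Derivation.map_one_eq_zero _) fun j hj => ?_
  · rw [Derivation.leibniz, hf, hh, smul_zero, smul_zero, add_zero]
  · rw [coeffPDeriv_X_sub_C, if_neg (Finset.ne_of_mem_erase hj).symm]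

theorem coeffPDeriv_nodal (i : Fin n) :
    coeffPDeriv i (nodal univ MvPolynomial.X) = -nodal (univ.erase i) MvPolynomial.X := by
  rw [nodal_eq_mul_nodal_erase (Finset.mem_univ i), Derivation.leibniz,
    coeffPDeriv_nodal_erase_self, coeffPDeriv_X_sub_C, if_pos rfl, smul_zero, zero_add, smul_eq_mul]
  ring

theorem coeffPDeriv_nodal_erase_mul_pow (i k : Fin n) {M : ℕ} (hM : 2 ≤ M) :
    coeffPDeriv i (nodal (univ.erase k) MvPolynomial.X * nodal univ MvPolynomial.X ^ (M - 1)) =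
      ((if i = k then 1 else 0) - (M : MvPolynomial (Fin n) ℤ)) •
        (nodal (univ.erase i) MvPolynomial.X * nodal (univ.erase k) MvPolynomial.X) *
          nodal univ MvPolynomial.X ^ (M - 2) := by
  obtain ⟨m, rfl⟩ := Nat.exists_eq_add_of_le' hM
  have h := derivation_mul_mul_pow_succ (coeffPDeriv i) (X - C (MvPolynomial.X k))
    (nodal (univ.erase k) MvPolynomial.X) m
  rw [← nodal_eq_mul_nodal_erase (Finset.mem_univ k), coeffPDeriv_nodal, coeffPDeriv_X_sub_C] at h
  refine h.trans ?_
  rw [smul_eq_C_mul, Nat.add_sub_cancel]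
  split_ifs with hik
  · subst hik
    simp only [Nat.cast_add, Nat.cast_ofNat, C_sub, C_1, C_add, map_natCast, map_ofNat]
    ring
  · simp only [Nat.cast_add, Nat.cast_ofNat, C_sub, C_0, C_add, map_natCast, map_ofNat]
    ring

end CoefficientwisePartialDerivative

noncomputable section Specialization

open Lagrange (nodal)
open Finset (univ)

variable {R : Type*} [CommRing R] {n g p q s : ℕ}

theorem map_aeval_nodal_X (t : Finset (Fin n)) (b : Fin n → R) :
    (nodal t MvPolynomial.X).map (MvPolynomial.aeval b : _ →ₐ[ℤ] R).toRingHom = nodal t b := by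
  rw [map_nodal]
  congr 1
  ext i
  simp

theorem map_aeval_hasseWitt (hg : g ≤ (p ^ expOrder p q) ^ s) (b : Fin n → R) :
    (hasseWitt n g p q s).map (MvPolynomial.aeval b) =
      hasseWittMatrix g ((p ^ expOrder p q) ^ s) (nodal univ b ^ masterExp p q s) := by
  have hmaster : hasseWitt n g p q s = hasseWittMatrix g ((p ^ expOrder p q) ^ s)
      (nodal univ MvPolynomial.X ^ masterExp p q s) := by
    ext1 u l
    set Q := (p ^ expOrder p q) ^ s with hQ
    have hle : Q ≤ (l + 1) * Q := Nat.le_mul_of_pos_left Q l.1.succ_pos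
    have hu : (u : ℕ) < Q := u.isLt.trans_le hg
    rw [hasseWitt, Matrix.of_apply, pow_mul, ← hQ, mul_comm Q]
    refine Eq.trans ?_ (coeff_X_pow_mul' _ _ _).symm
    rw [if_pos (by omega), Nat.sub_sub, add_comm 1]
    rfl
  rw [hmaster, ← map_aeval_nodal_X univ b, ← Polynomial.map_pow, hasseWittMatrix_map]
  rfl

theorem masterPoly_divByMonic (hs : 0 < masterExp p q s) (k : Fin n) :
    masterPoly n p q s /ₘ (X - C (MvPolynomial.X k)) =
      nodal (univ.erase k) MvPolynomial.X * nodal univ MvPolynomial.X ^ (masterExp p q s - 1) := by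
  have hdvd : masterPoly n p q s = (X - C (MvPolynomial.X k)) *
      (nodal (univ.erase k) MvPolynomial.X *
        nodal univ MvPolynomial.X ^ (masterExp p q s - 1)) := by
    rw [← mul_assoc, ← Lagrange.nodal_eq_mul_nodal_erase (Finset.mem_univ k),
      mul_pow_sub_one hs.ne']
    rfl
  rw [hdvd, mul_divByMonic_cancel_left _ (monic_X_sub_C _)]

theorem map_aeval_hypergeomSol (hs : 2 ≤ masterExp p q s) (b : Fin n → R) (k : Fin n) :
    (hypergeomSol n g p q s).map (MvPolynomial.aeval b) k =
      coeffRow g ((p ^ expOrder p q) ^ s)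
        (nodal univ b * nodal (univ.erase k) b * nodal univ b ^ (masterExp p q s - 2)) := by
  have hpow : nodal univ b ^ (masterExp p q s - 1) =
      nodal univ b * nodal univ b ^ (masterExp p q s - 2) := by
    rw [← pow_succ']
    congr 1
    omega
  rw [mul_comm (nodal univ b), mul_assoc, ← hpow, ← pow_mul]
  rw [← map_aeval_nodal_X univ b, ← map_aeval_nodal_X (univ.erase k) b, ← Polynomial.map_pow,
    ← Polynomial.map_mul, coeffRow_map, ← masterPoly_divByMonic (zero_lt_two.trans_le hs)]
  rfl

theorem map_aeval_pderivMatrix_hypergeomSol (hs : 2 ≤ masterExp p q s) (b : Fin n → R)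
    (i k : Fin n) :
    (pderivMatrix i (hypergeomSol n g p q s)).map (MvPolynomial.aeval b) k =
      ((if i = k then 1 else 0) - (masterExp p q s : R)) •
        coeffRow g ((p ^ expOrder p q) ^ s)
          (nodal (univ.erase i) b * nodal (univ.erase k) b *
            nodal univ b ^ (masterExp p q s - 2)) := by
  have hpderiv : pderivMatrix i (hypergeomSol n g p q s) k =
      ((if i = k then 1 else 0) - (masterExp p q s : MvPolynomial (Fin n) ℤ)) •
        coeffRow g ((p ^ expOrder p q) ^ s)
          (nodal (univ.erase i) MvPolynomial.X * nodal (univ.erase k) MvPolynomial.X *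
            nodal univ MvPolynomial.X ^ (masterExp p q s - 2)) := by
    rw [← map_smul, ← smul_mul_assoc, ← coeffPDeriv_nodal_erase_mul_pow i k hs,
      ← masterPoly_divByMonic (zero_lt_two.trans_le hs), ← pow_mul]
    rfl
  ext l
  rw [Matrix.map_apply, hpderiv, ← map_aeval_nodal_X univ b, ← map_aeval_nodal_X (univ.erase i) b,
    ← map_aeval_nodal_X (univ.erase k) b, ← Polynomial.map_pow, ← Polynomial.map_mul,
    ← Polynomial.map_mul, coeffRow_map]
  simp [apply_ite]

end Specialization

noncomputable section NormalizedSolutions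

open Lagrange (nodal)
open Finset (univ)

variable {R : Type*} [CommRing R] {n g p q s : ℕ} {b : Fin n → R}

/-- The matrix `V(b) * A(Φ_s)(b)⁻¹`, at a point `b` with coordinates in an arbitrary commutative
ring; it is meaningful when `A(Φ_s)(b)` is invertible over that ring. -/
def hasseWittNormalized (p q s : ℕ) (b : Fin n → R)
    (V : Matrix (Fin n) (Fin g) (MvPolynomial (Fin n) ℤ)) : Matrix (Fin n) (Fin g) R :=
  V.map (MvPolynomial.aeval b) * ((hasseWitt n g p q s).map (MvPolynomial.aeval b))⁻¹

theorem map_nonsing_inv {S ι : Type*} [CommRing S] [Fintype ι] [DecidableEq ι] (φ : R →+* S)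
    {A : Matrix ι ι R} (hA : IsUnit A.det) : A⁻¹.map φ = (A.map φ)⁻¹ := by
  refine (Matrix.inv_eq_right_inv ?_).symm
  rw [← Matrix.map_mul, Matrix.mul_nonsing_inv _ hA, Matrix.map_one _ (map_zero φ) (map_one φ)]

theorem map_aeval_comp {S ι κ : Type*} [CommRing S] (φ : R →+* S) (b : Fin n → R)
    (V : Matrix ι κ (MvPolynomial (Fin n) ℤ)) :
    V.map (MvPolynomial.aeval (φ ∘ b)) = (V.map (MvPolynomial.aeval b)).map φ := by
  ext i j
  exact (MvPolynomial.comp_aeval_apply b φ.toIntAlgHom (V i j)).symm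

theorem hasseWittNormalized_comp {S : Type*} [CommRing S] (φ : R →+* S)
    (h : IsUnit ((hasseWitt n g p q s).map (MvPolynomial.aeval b)).det)
    (V : Matrix (Fin n) (Fin g) (MvPolynomial (Fin n) ℤ)) :
    hasseWittNormalized p q s (φ ∘ b) V = (hasseWittNormalized p q s b V).map φ := by
  rw [hasseWittNormalized, hasseWittNormalized, map_aeval_comp, map_aeval_comp,
    ← map_nonsing_inv φ h, Matrix.map_mul]

theorem hasseWittNormalized_apply_eq_masterRow [Fact p.Prime] (hq : 0 < q)
    (hq2 : 2 * q < p ^ expOrder p q) (hg : g ≤ p ^ expOrder p q) (hs : 0 < s)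
    {V : Matrix (Fin n) (Fin g) (MvPolynomial (Fin n) ℤ)} {k : Fin n} {c : R} {E : R[X]}
    (hV : V.map (MvPolynomial.aeval b) k = c • coeffRow g ((p ^ expOrder p q) ^ s)
      (E * nodal univ b ^ (masterExp p q s - 2))) :
    hasseWittNormalized p q s b V k = c • masterRow g p q (nodal univ b) s E := by
  rw [masterRow_apply hq hq2 hs, hasseWittNormalized, Matrix.mul_apply_eq_vecMul, hV,
    map_aeval_hasseWitt (hg.trans (Nat.le_self_pow hs.ne' _)), Matrix.smul_vecMul]

theorem hasseWittNormalized_hypergeomSol [Fact p.Prime] (hq : 0 < q)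
    (hq2 : 2 * q < p ^ expOrder p q) (hg : g ≤ p ^ expOrder p q) (hs : 0 < s) (b : Fin n → R)
    (k : Fin n) :
    hasseWittNormalized p q s b (hypergeomSol n g p q s) k =
      masterRow g p q (nodal univ b) s (nodal univ b * nodal (univ.erase k) b) := by
  rw [← one_smul R (masterRow _ _ _ _ _ _)]
  refine hasseWittNormalized_apply_eq_masterRow hq hq2 hg hs ?_
  rw [one_smul, map_aeval_hypergeomSol (two_le_masterExp hq hq2 hs)]

theorem hasseWittNormalized_pderivMatrix_hypergeomSol [Fact p.Prime] (hq : 0 < q)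
    (hq2 : 2 * q < p ^ expOrder p q) (hg : g ≤ p ^ expOrder p q) (hs : 0 < s) (b : Fin n → R)
    (i k : Fin n) :
    hasseWittNormalized p q s b (pderivMatrix i (hypergeomSol n g p q s)) k =
      ((if i = k then 1 else 0) - (masterExp p q s : R)) •
        masterRow g p q (nodal univ b) s (nodal (univ.erase i) b * nodal (univ.erase k) b) :=
  hasseWittNormalized_apply_eq_masterRow hq hq2 hg hs
    (map_aeval_pderivMatrix_hypergeomSol (two_le_masterExp hq hq2 hs) b i k)

/-- The sum of the rows is the coefficient row of `-d/dt (Φ_s / (t - z_i))`. -/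
theorem dvd_sum_hasseWittNormalized_pderivMatrix [Fact p.Prime] (hq : 0 < q)
    (hq2 : 2 * q < p ^ expOrder p q) (hg : g ≤ p ^ expOrder p q) (hs : 0 < s) (b : Fin n → R)
    (i : Fin n) (l : Fin g) :
    (((p ^ expOrder p q) ^ s : ℕ) : R) ∣
      ∑ k, hasseWittNormalized p q s b (pderivMatrix i (hypergeomSol n g p q s)) k l := by
  set G := fun k => nodal (univ.erase k) b
  set M := masterExp p q s
  have hsum : ∑ k, hasseWittNormalized p q s b (pderivMatrix i (hypergeomSol n g p q s)) k l =
      -masterRow g p q (nodal univ b) s ((M : R) • ∑ k, G i * G k - G i ^ 2) l := by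
    simp only [hasseWittNormalized_pderivMatrix_hypergeomSol hq hq2 hg hs, Pi.smul_apply,
      smul_eq_mul, sub_mul, Finset.sum_sub_distrib, ite_mul, one_mul, zero_mul,
      Finset.sum_ite_eq, Finset.mem_univ, if_true, map_sub, map_smul, map_sum, Pi.sub_apply,
      Finset.sum_apply, Finset.mul_sum, neg_sub, sq, G, M]
  rw [hsum, dvd_neg]
  refine dvd_normalizedRow (fun m => ?_) l
  rw [← derivative_nodal_erase_mul_pow b (Finset.mem_univ i) (two_le_masterExp hq hq2 hs)]
  exact dvd_coeffRow_derivative _ _ _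

/-- Since `q * M_s + 1 = p ^ (e * s)`, the factor `-M_s` of the derivative equals `q⁻¹` modulo
`p ^ (e * s)`. -/
theorem dvd_hasseWittNormalized_sub_sub [Fact p.Prime] (hq : 0 < q)
    (hq2 : 2 * q < p ^ expOrder p q) (hg : g ≤ p ^ expOrder p q) (hs : 0 < s) (b : Fin n → R)
    (i k : Fin n) (l : Fin g) :
    (((p ^ expOrder p q) ^ s : ℕ) : R) ∣
      hasseWittNormalized p q s b (hypergeomSol n g p q s) i l -
        hasseWittNormalized p q s b (hypergeomSol n g p q s) k l -
        q * (b i - b k) *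
          hasseWittNormalized p q s b (pderivMatrix i (hypergeomSol n g p q s)) k l := by
  rcases eq_or_ne i k with rfl | hik
  · simp
  have hdiff : hasseWittNormalized p q s b (hypergeomSol n g p q s) i l -
      hasseWittNormalized p q s b (hypergeomSol n g p q s) k l = (b i - b k) *
        masterRow g p q (nodal univ b) s (nodal (univ.erase i) b * nodal (univ.erase k) b) l := by
    rw [hasseWittNormalized_hypergeomSol hq hq2 hg hs,
      hasseWittNormalized_hypergeomSol hq hq2 hg hs, ← Pi.sub_apply, ← map_sub,
      nodal_mul_nodal_erase_sub b (Finset.mem_univ i) (Finset.mem_univ k),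
      ← smul_eq_C_mul, map_smul, Pi.smul_apply, smul_eq_mul]
  rw [hdiff, hasseWittNormalized_pderivMatrix_hypergeomSol hq hq2 hg hs, if_neg hik,
    Pi.smul_apply, smul_eq_mul, ← mul_masterExp_add_one]
  refine Dvd.intro ((b i - b k) * masterRow g p q (nodal univ b) s
    (nodal (univ.erase i) b * nodal (univ.erase k) b) l) ?_
  push_cast
  ring

end NormalizedSolutions

noncomputable section NormalizedSolutionsCongruence

open Lagrange (nodal)
open Finset (univ)

variable {R : Type*} [CommRing R] [IsLocalRing R] {n g p q s : ℕ} [Fact p.Prime] {b : Fin n → R}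

theorem natDegree_nodal_univ_le (hn : n ≤ (g + 1) * q) (b : Fin n → R) :
    (nodal univ b).natDegree ≤ (g + 1) * q := by
  rwa [Lagrange.natDegree_nodal, Finset.card_univ, Fintype.card_fin]

theorem isUnit_det_map_aeval_hasseWitt (hpR : (p : R) ∈ IsLocalRing.maximalIdeal R) (hq : 0 < q)
    (hn : n ≤ (g + 1) * q) (hg : g ≤ p ^ expOrder p q)
    (h : IsUnit ((hasseWitt n g p q 1).map (MvPolynomial.aeval b)).det) (hs : 0 < s) :
    IsUnit ((hasseWitt n g p q s).map (MvPolynomial.aeval b)).det := by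
  rw [map_aeval_hasseWitt (by rwa [pow_one]), pow_one] at h
  rw [map_aeval_hasseWitt (hg.trans (Nat.le_self_pow hs.ne' _))]
  exact isUnit_det_hasseWittMatrix_masterExp hpR hq (natDegree_nodal_univ_le hn b) h hs

theorem pow_dvd_masterRow_nodal_add_sub (hpR : (p : R) ∈ IsLocalRing.maximalIdeal R)
    (hp0 : (p : R) ∈ nonZeroDivisors R) (hq : 0 < q) (hn : n ≤ (g + 1) * q)
    (hg : g ≤ p ^ expOrder p q) (hq2 : 2 * q < p ^ expOrder p q)
    (h : IsUnit ((hasseWitt n g p q 1).map (MvPolynomial.aeval b)).det) {E : R[X]}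
    (hE : E.natDegree < 2 * n) (hs : 0 < s) (k : ℕ) (l : Fin g) :
    (p : R) ^ s ∣
      masterRow g p q (nodal univ b) (s + k) E l - masterRow g p q (nodal univ b) s E l := by
  rw [map_aeval_hasseWitt (by rwa [pow_one]), pow_one] at h
  exact pow_dvd_masterRow_add_sub hpR hp0 hq hq2 (natDegree_nodal_univ_le hn b) h
    (by omega) hs k l

theorem pow_dvd_hasseWittNormalized_hypergeomSol_add_sub
    (hpR : (p : R) ∈ IsLocalRing.maximalIdeal R) (hp0 : (p : R) ∈ nonZeroDivisors R) (hq : 0 < q)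
    (hn : n ≤ (g + 1) * q) (hg : g ≤ p ^ expOrder p q) (hq2 : 2 * q < p ^ expOrder p q)
    (h : IsUnit ((hasseWitt n g p q 1).map (MvPolynomial.aeval b)).det) (hs : 0 < s) (t : ℕ)
    (k : Fin n) (l : Fin g) :
    (p : R) ^ s ∣ hasseWittNormalized p q (s + t) b (hypergeomSol n g p q (s + t)) k l -
      hasseWittNormalized p q s b (hypergeomSol n g p q s) k l := by
  rw [hasseWittNormalized_hypergeomSol hq hq2 hg (Nat.add_pos_left hs t),
    hasseWittNormalized_hypergeomSol hq hq2 hg hs]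
  refine pow_dvd_masterRow_nodal_add_sub hpR hp0 hq hn hg hq2 h ?_ hs t l
  simpa using natDegree_nodal_univ_mul_nodal_erase_lt b k

theorem pow_dvd_hasseWittNormalized_pderivMatrix_add_sub
    (hpR : (p : R) ∈ IsLocalRing.maximalIdeal R) (hp0 : (p : R) ∈ nonZeroDivisors R) (hq : 0 < q)
    (hn : n ≤ (g + 1) * q) (hg : g ≤ p ^ expOrder p q) (hq2 : 2 * q < p ^ expOrder p q)
    (h : IsUnit ((hasseWitt n g p q 1).map (MvPolynomial.aeval b)).det) (hs : 0 < s) (t : ℕ)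
    (i k : Fin n) (l : Fin g) :
    (p : R) ^ s ∣
      hasseWittNormalized p q (s + t) b (pderivMatrix i (hypergeomSol n g p q (s + t))) k l -
        hasseWittNormalized p q s b (pderivMatrix i (hypergeomSol n g p q s)) k l := by
  rw [hasseWittNormalized_pderivMatrix_hypergeomSol hq hq2 hg (Nat.add_pos_left hs t),
    hasseWittNormalized_pderivMatrix_hypergeomSol hq hq2 hg hs]
  refine dvd_mul_sub_mul ?_ (pow_dvd_masterRow_nodal_add_sub hpR hp0 hq hn hg hq2 h ?_ hs t l)
  · rw [sub_sub_sub_cancel_left, ← neg_sub, dvd_neg]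
    exact pow_dvd_masterExp_add_sub hq hq2 s t
  · simpa using natDegree_nodal_erase_mul_nodal_erase_lt b i k

end NormalizedSolutionsCongruence

section UnitBall

variable (K : Type*) [NormedField K] [IsUltrametricDist K]

/-- The closed unit ball of a nonarchimedean normed field, as a valuation subring. -/
noncomputable abbrev unitBall : ValuationSubring K :=
  (NormedField.valuation (K := K)).valuationSubring

variable {K}

theorem norm_coe_unitBall_le_one (x : unitBall K) : ‖(x : K)‖ ≤ 1 := x.2

theorem isUnit_unitBall_iff {x : unitBall K} : IsUnit x ↔ ‖(x : K)‖ = 1 := by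
  rw [(Valuation.valuationSubring.integers _).isUnit_iff_valuation_eq_one,
    NormedField.valuation_apply, ← NNReal.coe_inj]
  rfl

variable {p : ℕ}

theorem natCast_mem_maximalIdeal_unitBall (hp : ‖(p : K)‖ < 1) :
    (p : unitBall K) ∈ IsLocalRing.maximalIdeal (unitBall K) := by
  rw [IsLocalRing.mem_maximalIdeal, mem_nonunits_iff, isUnit_unitBall_iff]
  exact hp.ne

theorem natCast_mem_nonZeroDivisors_unitBall [CharZero K] (hp : p ≠ 0) :
    (p : unitBall K) ∈ nonZeroDivisors (unitBall K) :=
  mem_nonZeroDivisors_of_ne_zero fun h =>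
    hp (Nat.cast_eq_zero.1 (congrArg (Subtype.val : unitBall K → K) h))

theorem norm_coe_le_of_natCast_pow_dvd {x : unitBall K} {s : ℕ} (h : (p : unitBall K) ^ s ∣ x) :
    ‖(x : K)‖ ≤ ‖(p : K)‖ ^ s := by
  obtain ⟨y, rfl⟩ := h
  calc ‖(p : K) ^ s * y‖ = ‖(p : K)‖ ^ s * ‖(y : K)‖ := by rw [norm_mul, norm_pow]
    _ ≤ ‖(p : K)‖ ^ s := mul_le_of_le_one_right (by positivity) (norm_coe_unitBall_le_one y)

end UnitBall

section UniformLimits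

variable {α β : Type*} {D : Set α}

theorem exists_tendstoUniformlyOn_of_dist_le [PseudoMetricSpace β] [CompleteSpace β] [Nonempty β]
    {r : ℝ} (hr0 : 0 ≤ r) (hr : r < 1) {u : ℕ → α → β}
    (hu : ∀ s, 0 < s → ∀ t, ∀ a ∈ D, dist (u (s + t) a) (u s a) ≤ r ^ s) :
    ∃ L : α → β, TendstoUniformlyOn u L atTop D := by
  have hcauchy : UniformCauchySeqOn u atTop D := by
    refine Metric.uniformCauchySeqOn_iff.2 fun ε hε => ?_
    obtain ⟨N, hN⟩ := exists_pow_lt_of_lt_one (half_pos hε) hr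
    have hdist : ∀ s ≥ N + 1, ∀ a ∈ D, dist (u s a) (u (N + 1) a) < ε / 2 := fun s hs a ha => by
      obtain ⟨t, rfl⟩ := Nat.exists_eq_add_of_le hs
      exact (hu (N + 1) N.succ_pos t a ha).trans_lt
        ((pow_le_pow_of_le_one hr0 hr.le N.le_succ).trans_lt hN)
    refine ⟨N + 1, fun s hs t ht a ha => ?_⟩
    linarith [dist_triangle_right (u s a) (u t a) (u (N + 1) a), hdist s hs a ha, hdist t ht a ha]
  have hlim : ∀ a, ∃ y, a ∈ D → Tendsto (u · a) atTop (nhds y) := fun a => by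
    by_cases ha : a ∈ D
    · exact (cauchySeq_tendsto_of_complete (hcauchy.cauchySeq ha)).imp fun _ h _ => h
    · exact ⟨Classical.arbitrary β, fun h => absurd h ha⟩
  choose L hL using hlim
  exact ⟨L, hcauchy.tendstoUniformlyOn_of_tendsto hL⟩

theorem exists_tendstoUniformlyOn_matrix {K ι κ : Type*} [NormedField K] [CompleteSpace K]
    {r : ℝ} (hr0 : 0 ≤ r) (hr : r < 1) {u : ℕ → α → Matrix ι κ K}
    (hu : ∀ s, 0 < s → ∀ t, ∀ a ∈ D, ∀ i j, ‖u (s + t) a i j - u s a i j‖ ≤ r ^ s) :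
    ∃ L : α → Matrix ι κ K, TendstoUniformlyOn u L atTop D := by
  have hentry : ∀ i j, ∃ L : α → K, TendstoUniformlyOn (u · · i j) L atTop D := fun i j =>
    exists_tendstoUniformlyOn_of_dist_le hr0 hr fun s hs t a ha => by
      rw [dist_eq_norm]
      exact hu s hs t a ha i j
  choose L hL using hentry
  refine ⟨fun a => Matrix.of fun i j => L i j a, ?_⟩
  simp only [tendstoUniformlyOn_iff_tendsto, Matrix.uniformity, tendsto_iInf, tendsto_comap_iff]
  exact fun i j => tendstoUniformlyOn_iff_tendsto.1 (hL i j)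

theorem eq_zero_of_tendsto_of_norm_le_pow {E : Type*} [NormedAddCommGroup E] {r : ℝ} (hr0 : 0 ≤ r)
    (hr : r < 1) {x : ℕ → E} {L : E} (hx : Tendsto x atTop (nhds L))
    (h : ∀ s, 0 < s → ‖x s‖ ≤ r ^ s) : L = 0 :=
  tendsto_nhds_unique hx (squeeze_zero_norm' ((eventually_gt_atTop 0).mono h)
    (tendsto_pow_atTop_nhds_zero_of_lt_one hr0 hr))

end UniformLimits

section GaudinHamiltonian

open Finset (univ)
open Matrix (vecMulVec)

variable {K : Type*} [Field K] {n : ℕ} {κ : Type*} {q : ℕ} {a : Fin n → K}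
  {I I' : Matrix (Fin n) κ K} {i : Fin n}

theorem Omega_mul (i j : Fin n) (I : Matrix (Fin n) κ K) :
    Omega K i j * I = vecMulVec (Pi.single j 1 - Pi.single i 1) (I i - I j) := by
  have hOmega : Omega K i j = vecMulVec (Pi.single j 1 - Pi.single i 1)
      (Pi.single i 1 - Pi.single j 1) := by
    rw [Omega]
    simp only [Matrix.single_eq_single_vecMulVec_single, Matrix.sub_vecMulVec, Matrix.vecMulVec_sub]
    abel
  rw [hOmega, Matrix.vecMulVec_mul]
  simp [Matrix.sub_vecMul, Matrix.row]

theorem eq_sum_vecMulVec (hsum : ∀ l, ∑ k, I' k l = 0) (i : Fin n) :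
    I' = ∑ j ∈ univ.erase i, vecMulVec (Pi.single j 1 - Pi.single i 1) (I' j) := by
  rw [Finset.sum_erase _ (by simp)]
  ext k l
  simp [Matrix.sum_apply, Matrix.vecMulVec_apply, sub_mul, hsum l,
    Pi.single_apply]

theorem inv_smul_Omega_mul (hq : (q : K) ≠ 0)
    (hrow : ∀ k l, I i l - I k l = q * (a i - a k) * I' k l) (j : Fin n) :
    (q : K)⁻¹ • (Omega K i j * I) =
      (a i - a j) • vecMulVec (Pi.single j 1 - Pi.single i 1) (I' j) := by
  rw [Omega_mul]
  ext k l
  rw [Matrix.smul_apply, Matrix.smul_apply, Matrix.vecMulVec_apply, Matrix.vecMulVec_apply,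
    Pi.sub_apply (I i), hrow, smul_eq_mul, smul_eq_mul]
  field_simp

theorem eq_gaudinH_mul (hq : (q : K) ≠ 0) (hsum : ∀ l, ∑ k, I' k l = 0)
    (hrow : ∀ k l, I i l - I k l = q * (a i - a k) * I' k l) (ha : ∀ j, j ≠ i → a i ≠ a j) :
    I' = gaudinH q i a * I := by
  rw [gaudinH, Matrix.smul_mul, Matrix.sum_mul, Finset.smul_sum]
  refine (eq_sum_vecMulVec hsum i).trans (Finset.sum_congr rfl fun j hj => ?_)
  rw [Matrix.smul_mul, smul_comm, inv_smul_Omega_mul hq hrow,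
    inv_smul_smul₀ (sub_ne_zero.2 (ha j (Finset.ne_of_mem_erase hj)))]

theorem prod_smul_eq_sum_Omega_mul (hq : (q : K) ≠ 0) (hsum : ∀ l, ∑ k, I' k l = 0)
    (hrow : ∀ k l, I i l - I k l = q * (a i - a k) * I' k l) :
    (∏ j ∈ univ.erase i, (a i - a j)) • I' =
      (q : K)⁻¹ • ∑ j ∈ univ.erase i,
        (∏ k ∈ (univ.erase i).erase j, (a i - a k)) • (Omega K i j * I) := by
  conv_lhs => rw [eq_sum_vecMulVec hsum i]
  rw [Finset.smul_sum, Finset.smul_sum]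
  refine Finset.sum_congr rfl fun j hj => ?_
  rw [smul_comm (q : K)⁻¹, inv_smul_Omega_mul hq hrow, smul_smul, Finset.prod_erase_mul _ _ hj]

end GaudinHamiltonian

section HasseWittDomain

variable {K : Type*} [NormedField K] [IsUltrametricDist K] {n g p q s : ℕ} {a : Fin n → K}

/-- The domain `𝔇_KZ` over an arbitrary nonarchimedean normed field `K`: the points of the closed
unit polydisc at which the Hasse-Witt determinant `det A(Φ_1)` has norm one. -/
def hasseWittDomain (K : Type*) [NormedField K] (n g p q : ℕ) : Set (Fin n → K) :=
  {a | (∀ i, ‖a i‖ ≤ 1) ∧ ‖(evalMatrix a (hasseWitt n g p q 1)).det‖ = 1}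

theorem exists_unitBall_lift (ha : a ∈ hasseWittDomain K n g p q) :
    ∃ b : Fin n → unitBall K, a = (unitBall K).subtype ∘ b ∧
      IsUnit ((hasseWitt n g p q 1).map (MvPolynomial.aeval b)).det := by
  let b : Fin n → unitBall K := fun i => ⟨a i, ha.1 i⟩
  have hdet : (evalMatrix a (hasseWitt n g p q 1)).det =
      (((hasseWitt n g p q 1).map (MvPolynomial.aeval b)).det : K) :=
    (congrArg Matrix.det (map_aeval_comp (unitBall K).subtype b _)).trans
      ((unitBall K).subtype.map_det _).symm
  exact ⟨b, rfl, isUnit_unitBall_iff.2 (hdet ▸ ha.2)⟩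

variable [Fact p.Prime]

theorem exists_hasseWittNormalized_eq_coe (hp : ‖(p : K)‖ < 1) (hq : 0 < q)
    (hn : n ≤ (g + 1) * q) (hg : g ≤ p ^ expOrder p q) (ha : a ∈ hasseWittDomain K n g p q) :
    ∃ b : Fin n → unitBall K, (∀ i, a i = b i) ∧
      IsUnit ((hasseWitt n g p q 1).map (MvPolynomial.aeval b)).det ∧
      ∀ s, 0 < s → ∀ (V : Matrix (Fin n) (Fin g) (MvPolynomial (Fin n) ℤ)) k l,
        hasseWittNormalized p q s a V k l = hasseWittNormalized p q s b V k l := by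
  obtain ⟨b, rfl, hb⟩ := exists_unitBall_lift ha
  refine ⟨b, fun _ => rfl, hb, fun s hs V k l => ?_⟩
  rw [hasseWittNormalized_comp _ (isUnit_det_map_aeval_hasseWitt
    (natCast_mem_maximalIdeal_unitBall hp) hq hn hg hb hs)]
  rfl

theorem norm_hasseWittNormalized_hypergeomSol_add_sub_le [CharZero K] (hp : ‖(p : K)‖ < 1)
    (hq : 0 < q) (hn : n ≤ (g + 1) * q) (hg : g ≤ p ^ expOrder p q)
    (hq2 : 2 * q < p ^ expOrder p q) (hs : 0 < s) (t : ℕ) (ha : a ∈ hasseWittDomain K n g p q)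
    (k : Fin n) (l : Fin g) :
    ‖hasseWittNormalized p q (s + t) a (hypergeomSol n g p q (s + t)) k l -
      hasseWittNormalized p q s a (hypergeomSol n g p q s) k l‖ ≤ ‖(p : K)‖ ^ s := by
  obtain ⟨b, -, hb, hcoe⟩ := exists_hasseWittNormalized_eq_coe hp hq hn hg ha
  rw [hcoe _ (Nat.add_pos_left hs t), hcoe s hs]
  exact norm_coe_le_of_natCast_pow_dvd (pow_dvd_hasseWittNormalized_hypergeomSol_add_sub
    (natCast_mem_maximalIdeal_unitBall hp)
    (natCast_mem_nonZeroDivisors_unitBall (Fact.out : p.Prime).ne_zero) hq hn hg hq2 hb hs t k l)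

theorem norm_hasseWittNormalized_pderivMatrix_add_sub_le [CharZero K] (hp : ‖(p : K)‖ < 1)
    (hq : 0 < q) (hn : n ≤ (g + 1) * q) (hg : g ≤ p ^ expOrder p q)
    (hq2 : 2 * q < p ^ expOrder p q) (i : Fin n) (hs : 0 < s) (t : ℕ)
    (ha : a ∈ hasseWittDomain K n g p q) (k : Fin n) (l : Fin g) :
    ‖hasseWittNormalized p q (s + t) a (pderivMatrix i (hypergeomSol n g p q (s + t))) k l -
      hasseWittNormalized p q s a (pderivMatrix i (hypergeomSol n g p q s)) k l‖ ≤
        ‖(p : K)‖ ^ s := by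
  obtain ⟨b, -, hb, hcoe⟩ := exists_hasseWittNormalized_eq_coe hp hq hn hg ha
  rw [hcoe _ (Nat.add_pos_left hs t), hcoe s hs]
  exact norm_coe_le_of_natCast_pow_dvd (pow_dvd_hasseWittNormalized_pderivMatrix_add_sub
    (natCast_mem_maximalIdeal_unitBall hp)
    (natCast_mem_nonZeroDivisors_unitBall (Fact.out : p.Prime).ne_zero) hq hn hg hq2 hb hs t i k l)

theorem norm_sum_hasseWittNormalized_pderivMatrix_le (hp : ‖(p : K)‖ < 1) (hq : 0 < q)
    (hn : n ≤ (g + 1) * q) (hg : g ≤ p ^ expOrder p q) (hq2 : 2 * q < p ^ expOrder p q)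
    (hs : 0 < s) (ha : a ∈ hasseWittDomain K n g p q) (i : Fin n) (l : Fin g) :
    ‖∑ k, hasseWittNormalized p q s a (pderivMatrix i (hypergeomSol n g p q s)) k l‖ ≤
      ‖(p : K)‖ ^ s := by
  obtain ⟨b, -, -, hcoe⟩ := exists_hasseWittNormalized_eq_coe hp hq hn hg ha
  simp only [hcoe s hs]
  have hdvd := (pow_dvd_pow_expOrder_pow hq hq2 s).trans
    (dvd_sum_hasseWittNormalized_pderivMatrix hq hq2 hg hs b i l)
  simpa using norm_coe_le_of_natCast_pow_dvd hdvd

theorem norm_hasseWittNormalized_sub_sub_le (hp : ‖(p : K)‖ < 1) (hq : 0 < q)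
    (hn : n ≤ (g + 1) * q) (hg : g ≤ p ^ expOrder p q) (hq2 : 2 * q < p ^ expOrder p q)
    (hs : 0 < s) (ha : a ∈ hasseWittDomain K n g p q) (i k : Fin n) (l : Fin g) :
    ‖hasseWittNormalized p q s a (hypergeomSol n g p q s) i l -
      hasseWittNormalized p q s a (hypergeomSol n g p q s) k l -
      q * (a i - a k) *
        hasseWittNormalized p q s a (pderivMatrix i (hypergeomSol n g p q s)) k l‖ ≤
      ‖(p : K)‖ ^ s := by
  obtain ⟨b, hab, -, hcoe⟩ := exists_hasseWittNormalized_eq_coe hp hq hn hg ha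
  simp only [hcoe s hs, hab]
  have hdvd := (pow_dvd_pow_expOrder_pow hq hq2 s).trans
    (dvd_hasseWittNormalized_sub_sub hq hq2 hg hs b i k l)
  simpa using norm_coe_le_of_natCast_pow_dvd hdvd

theorem sum_eq_zero_of_tendsto_hasseWittNormalized (hp : ‖(p : K)‖ < 1) (hq : 0 < q)
    (hn : n ≤ (g + 1) * q) (hg : g ≤ p ^ expOrder p q) (hq2 : 2 * q < p ^ expOrder p q)
    (ha : a ∈ hasseWittDomain K n g p q) {i : Fin n} {L : Matrix (Fin n) (Fin g) K}
    (hL : Tendsto (fun s => hasseWittNormalized p q s a (pderivMatrix i (hypergeomSol n g p q s)))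
      atTop (nhds L)) (l : Fin g) :
    ∑ k, L k l = 0 :=
  eq_zero_of_tendsto_of_norm_le_pow (norm_nonneg _) hp
    (tendsto_finsetSum _ fun k _ => (hL.apply_nhds k).apply_nhds l)
    fun _ hs => norm_sum_hasseWittNormalized_pderivMatrix_le hp hq hn hg hq2 hs ha i l

theorem sub_eq_of_tendsto_hasseWittNormalized (hp : ‖(p : K)‖ < 1) (hq : 0 < q)
    (hn : n ≤ (g + 1) * q) (hg : g ≤ p ^ expOrder p q) (hq2 : 2 * q < p ^ expOrder p q)
    (ha : a ∈ hasseWittDomain K n g p q) {i : Fin n} {L L' : Matrix (Fin n) (Fin g) K}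
    (hL : Tendsto (fun s => hasseWittNormalized p q s a (hypergeomSol n g p q s)) atTop (nhds L))
    (hL' : Tendsto (fun s => hasseWittNormalized p q s a (pderivMatrix i (hypergeomSol n g p q s)))
      atTop (nhds L')) (k : Fin n) (l : Fin g) :
    L i l - L k l = q * (a i - a k) * L' k l :=
  sub_eq_zero.1 <| eq_zero_of_tendsto_of_norm_le_pow (norm_nonneg _) hp
    ((((hL.apply_nhds i).apply_nhds l).sub ((hL.apply_nhds k).apply_nhds l)).sub
      (((hL'.apply_nhds k).apply_nhds l).const_mul _))
    fun _ hs => norm_hasseWittNormalized_sub_sub_le hp hq hn hg hq2 hs ha i k l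

end HasseWittDomain

section UnramifiedExt

variable (p m : ℕ) [Fact p.Prime]

theorem UnramifiedExt.norm_natCast_lt_one : ‖(p : UnramifiedExt p m)‖ < 1 := by
  have h : ((p : UnramifiedExt p m) : PadicAlgCl p) = algebraMap ℚ_[p] (PadicAlgCl p) p := by simp
  change ‖((p : UnramifiedExt p m) : PadicAlgCl p)‖ < 1
  rw [h, norm_algebraMap']
  exact Padic.norm_p_lt_one

theorem UnramifiedExt.completeSpace (hm : 0 < m) : CompleteSpace (UnramifiedExt p m) := by
  have hpm : 0 < p ^ m - 1 := Nat.sub_pos_of_lt (Nat.one_lt_pow hm.ne' (Fact.out : p.Prime).one_lt)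
  have hfin : Set.Finite {x : PadicAlgCl p | x ^ (p ^ m - 1) = 1} :=
    (Multiset.finite_toSet (nthRoots (p ^ m - 1) (1 : PadicAlgCl p))).subset fun x hx =>
      (mem_nthRoots hpm).2 hx
  have : Finite {x : PadicAlgCl p | x ^ (p ^ m - 1) = 1} := hfin
  have : FiniteDimensional ℚ_[p] (UnramifiedExt p m) :=
    IntermediateField.finiteDimensional_adjoin fun x _ =>
      (Algebra.IsAlgebraic.isAlgebraic x).isIntegral
  exact FiniteDimensional.complete ℚ_[p] (UnramifiedExt p m)

end UnramifiedExt

theorem mainTheorem8_general {K : Type*} [NormedField K] [IsUltrametricDist K] [CompleteSpace K]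
    [CharZero K] (p q g n : ℕ) [Fact p.Prime] (hp : ‖(p : K)‖ < 1) (hq : 0 < q)
    (hn : n ≤ (g + 1) * q) (hg : g ≤ p ^ expOrder p q) (hq2 : 2 * q < p ^ expOrder p q) :
    ∃ (I : (Fin n → K) → Matrix (Fin n) (Fin g) K)
      (I' : Fin n → (Fin n → K) → Matrix (Fin n) (Fin g) K),
      TendstoUniformlyOn
        (fun (s : ℕ) (a : Fin n → K) =>
          evalMatrix a (hypergeomSol n g p q s) * (evalMatrix a (hasseWitt n g p q s))⁻¹)
        I atTop (hasseWittDomain K n g p q) ∧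
      (∀ i, TendstoUniformlyOn
        (fun (s : ℕ) (a : Fin n → K) =>
          evalMatrix a (pderivMatrix i (hypergeomSol n g p q s)) *
            (evalMatrix a (hasseWitt n g p q s))⁻¹)
        (I' i) atTop (hasseWittDomain K n g p q)) ∧
      (∀ i, ∀ a ∈ hasseWittDomain K n g p q, (∀ j, j ≠ i → a i ≠ a j) →
        I' i a = gaudinH q i a * I a) ∧
      (∀ i, ∀ a ∈ hasseWittDomain K n g p q,
        (∏ j ∈ Finset.univ.erase i, (a i - a j)) • I' i a =
          (q : K)⁻¹ • ∑ j ∈ Finset.univ.erase i,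
            (∏ k ∈ (Finset.univ.erase i).erase j, (a i - a k)) • (Omega K i j * I a)) := by
  obtain ⟨I, hI⟩ := exists_tendstoUniformlyOn_matrix
    (u := fun s a => hasseWittNormalized p q s a (hypergeomSol n g p q s)) (norm_nonneg _) hp
    fun s hs t a ha => norm_hasseWittNormalized_hypergeomSol_add_sub_le hp hq hn hg hq2 hs t ha
  choose I' hI' using fun i => exists_tendstoUniformlyOn_matrix
    (u := fun s a => hasseWittNormalized p q s a (pderivMatrix i (hypergeomSol n g p q s)))
    (norm_nonneg _) hp fun s hs t a ha =>
      norm_hasseWittNormalized_pderivMatrix_add_sub_le hp hq hn hg hq2 i hs t ha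
  have hsum : ∀ i, ∀ a ∈ hasseWittDomain K n g p q, ∀ l, ∑ k, I' i a k l = 0 := fun i a ha =>
    sum_eq_zero_of_tendsto_hasseWittNormalized hp hq hn hg hq2 ha ((hI' i).tendsto_at ha)
  have hrow : ∀ i, ∀ a ∈ hasseWittDomain K n g p q, ∀ k l,
      I a i l - I a k l = q * (a i - a k) * I' i a k l := fun i a ha =>
    sub_eq_of_tendsto_hasseWittNormalized hp hq hn hg hq2 ha (hI.tendsto_at ha)
      ((hI' i).tendsto_at ha)
  have hq0 : (q : K) ≠ 0 := Nat.cast_ne_zero.2 hq.ne'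
  exact ⟨I, I', hI, hI', fun i a ha => eq_gaudinH_mul hq0 (hsum i a ha) (hrow i a ha),
    fun i a ha => prod_smul_eq_sum_Omega_mul hq0 (hsum i a ha) (hrow i a ha)⟩

theorem mainTheorem8 (p q g n m : ℕ) [Fact p.Prime] (hq : q.Prime) (hpq : q < p)
    (hg : 0 < g) (hn : n = g * q + 1) (hpe : n < p ^ expOrder p q) (hpn : n + q ≤ p + 2)
    (hm : 0 < m) :
    ∃ (I : (Fin n → UnramifiedExt p m) → Matrix (Fin n) (Fin g) (UnramifiedExt p m))
      (I' : Fin n → (Fin n → UnramifiedExt p m) → Matrix (Fin n) (Fin g) (UnramifiedExt p m)),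
      -- `I` is the uniform limit of `I_s · A(Φ_s)⁻¹` on the domain
      TendstoUniformlyOn
        (fun (s : ℕ) (a : Fin n → UnramifiedExt p m) =>
          evalMatrix a (hypergeomSol n g p q s) * (evalMatrix a (hasseWitt n g p q s))⁻¹)
        I atTop (domainKZ n g p q m) ∧
      -- `I' i` is the uniform limit of `(∂I_s/∂z_i) · A(Φ_s)⁻¹` on the domain
      (∀ i, TendstoUniformlyOn
        (fun (s : ℕ) (a : Fin n → UnramifiedExt p m) =>
          evalMatrix a (pderivMatrix i (hypergeomSol n g p q s)) *
            (evalMatrix a (hasseWitt n g p q s))⁻¹)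
        (I' i) atTop (domainKZ n g p q m)) ∧
      -- the equation `I' i = H_i · I` away from the poles of `H_i`
      (∀ i, ∀ a ∈ domainKZ n g p q m, (∀ j, j ≠ i → a i ≠ a j) →
        I' i a = gaudinH q i a * I a) ∧
      -- the same equation, multiplied by `∏_{j ≠ i} (z_i - z_j)`, on the whole domain
      (∀ i, ∀ a ∈ domainKZ n g p q m,
        (∏ j ∈ Finset.univ.erase i, (a i - a j)) • I' i a =
          (q : UnramifiedExt p m)⁻¹ • ∑ j ∈ Finset.univ.erase i,
            (∏ k ∈ (Finset.univ.erase i).erase j, (a i - a k)) •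
              (Omega (UnramifiedExt p m) i j * I a)) := by
  have hgQ : g ≤ p ^ expOrder p q :=
    (Nat.le_mul_of_pos_right g hq.pos).trans (by omega)
  have := UnramifiedExt.completeSpace p m hm
  exact mainTheorem8_general p q g n (UnramifiedExt.norm_natCast_lt_one p m) hq.pos
    (by linarith [hq.pos]) hgQ (two_mul_lt_pow_expOrder hg (hn ▸ hpe))
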